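/- For $0<k<1$ and an integer $m\ge 2$ let $B_m=B_{m,k}$ be the $m\times m$ matrix $$B_m(x,y)=\frac1{m^2}\Bigl(1-k\cos\bigl(2\pi\tfrac{(x-1)+(y-1)}{m}\bigr)\Bigr),\qquad x,y\in\{1,\dots,m\},$$ which for $m\ge3$ is $1/m^2$ times the slack matrix of two concentric regular $m$-gons (the outer one with inscribed circle of radius $1$, the inner one with circumscribed circle of radius $k$). For a correlation $P$ (a joint probability distribution on $[n]\times[n]$), let $\mathrm R(P)$ be the least value of $\lceil\log_2 d\rceil$ such that $P$ can be obtained from a probability distribution on $[d]\times[d]$ by stochastic maps applied locally to the two coordinates. For $0\le\lambda\le1$ let $\mathcal E_\lambda(\rho)=(1-\lambda)\rho+\lambda\operatorname{tr}(\rho)I_d/d$. A density operator $\sigma$ on $\mathbb C^d\otimes\mathbb C^d$ generates $P$ under noise $\lambda$ if there are POVMs $\{E_x\},\{F_y\}$ on $\mathbb C^d$ with $P(x,y)=\operatorname{tr}\bigl((E_x\otimes F_y)\,(\mathcal E_\lambda\otimes\mathcal E_\lambda)(\sigma)\bigr)$ for all $x,y$; $P$ is reachable under noise $\lambda$ if some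 such $d,\sigma$ exist. The quantum advantage is $$\mathcal S_\lambda(P)=\frac{\mathrm R(P)}{\inf_\sigma\lceil\log_2 d\rceil},$$ the infimum being over all $d$ and all $\sigma$ on $\mathbb C^d\otimes\mathbb C^d$ that generate $P$ under noise $\lambda$, and $\infty$ (so that $\mathcal S_\lambda(P)=0$) if there are none. An $r\times r$ $\mathcal E_\lambda$-PSD factorization of $P$ consists of positive semidefinite $C_x,D_y\in\mathbb C^{r\times r}$ with $P(x,y)=\operatorname{tr}(C_xD_y)$, with $C=\sum_aC_a$ and $D=\sum_bD_b$ invertible, such that all $C_x-\frac\lambda r\operatorname{tr}(C_xC^{-1})\,C$ and $D_y-\frac\lambda r\operatorname{tr}(D_yD^{-1})\,D$ are positive semidefinite. **Theorem.** 1. For all $0<k<1$ and $m\ge2$, $B_m$ is a correlation, and for every $0\le\lambda\le1-\sqrt k$ it has a $2\times2$ $\mathcal E_\lambda$-PSD factorization, it is reachable under noise $\lambda$, and $\mathcal S_\lambda(B_m)=\mathrm R(B_m)$, independently of $\lambda$. 2. There is an absolute constant $c>0$ such that $\mathcal S_\lambda(B_m)\ge c\log\log m$ for all $m\ge3$, all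 $0<k<1$ with $k>\frac{\cos(2\pi/m)}{\cos^2(\pi/m)}$, and all $0\le\lambda\le1-\sqrt k$. 3. For all $0<k<1$, $m\ge2$ and $1-\sqrt k<\lambda\le1$, $B_m$ is not reachable under noise $\lambda$, and $\mathcal S_\lambda(B_m)=0$. -/

import Mathlib

open scoped Kronecker ENNReal ComplexOrder

noncomputable section

namespace CorrelationGeneration

/-- A classical correlation: a joint probability distribution of two outcomes in `Fin n`. -/
structure IsCorrelation {n : ℕ} (P : Matrix (Fin n) (Fin n) ℝ) : Prop where
  nonneg : ∀ x y, 0 ≤ P x y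
  sum_eq_one : ∑ x, ∑ y, P x y = 1

/-- A local classical operation: `K i x` is the probability of output `x` on input `i`. -/
structure IsStochastic {d n : ℕ} (K : Matrix (Fin d) (Fin n) ℝ) : Prop where
  nonneg : ∀ i x, 0 ≤ K i x
  sum_eq_one : ∀ i, ∑ x, K i x = 1

/-- The seed correlation `P'` generates `P` by local classical operations. -/
def ClassicallyGenerates {d n : ℕ} (P' : Matrix (Fin d) (Fin d) ℝ)
    (P : Matrix (Fin n) (Fin n) ℝ) : Prop :=
  ∃ K L : Matrix (Fin d) (Fin n) ℝ, IsStochastic K ∧ IsStochastic L ∧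
    ∀ x y, P x y = ∑ i, ∑ j, P' i j * K i x * L j y

/-- The size of a bipartite seed of local dimension `d`, that is, half of the total number of
(qu)bits needed to record it: `⌈log₂ d⌉` on each side. -/
def seedSize (d : ℕ) : ℝ≥0∞ := (Nat.clog 2 d : ℝ≥0∞)

/-- The classical correlation complexity `R(P)`: the least size of a seed correlation that
generates `P`. -/
def classicalComplexity {n : ℕ} (P : Matrix (Fin n) (Fin n) ℝ) : ℝ≥0∞ :=
  ⨅ (d : ℕ) (P' : Matrix (Fin d) (Fin d) ℝ) (_ : IsCorrelation P')
    (_ : ClassicallyGenerates P' P), seedSize d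

/-- Density operators on `ℂ^d ⊗ ℂ^d`. -/
structure IsBipartiteState {d : ℕ} (σ : Matrix (Fin d × Fin d) (Fin d × Fin d) ℂ) : Prop where
  posSemidef : σ.PosSemidef
  trace_eq_one : σ.trace = 1

/-- A POVM on `ℂ^d` with outcomes in `Fin n`. -/
structure IsPOVM {d n : ℕ} (E : Fin n → Matrix (Fin d) (Fin d) ℂ) : Prop where
  posSemidef : ∀ x, (E x).PosSemidef
  sum_eq_one : ∑ x, E x = 1

/-- The depolarizing channel `ρ ↦ (1 - lam) ρ + lam tr(ρ) I / d`. -/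
def depolarize (lam : ℝ) {d : ℕ} (ρ : Matrix (Fin d) (Fin d) ℂ) : Matrix (Fin d) (Fin d) ℂ :=
  (1 - lam : ℂ) • ρ + ((lam : ℂ) * ρ.trace / (d : ℂ)) • (1 : Matrix (Fin d) (Fin d) ℂ)

/-- `Φ ⊗ id`: the map `Φ` applied to the first tensor factor. -/
def onFirst {d : ℕ} (Φ : Matrix (Fin d) (Fin d) ℂ → Matrix (Fin d) (Fin d) ℂ)
    (σ : Matrix (Fin d × Fin d) (Fin d × Fin d) ℂ) :
    Matrix (Fin d × Fin d) (Fin d × Fin d) ℂ :=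
  Matrix.of fun p q => Φ (Matrix.of fun i j => σ (i, p.2) (j, q.2)) p.1 q.1

/-- `id ⊗ Φ`: the map `Φ` applied to the second tensor factor. -/
def onSecond {d : ℕ} (Φ : Matrix (Fin d) (Fin d) ℂ → Matrix (Fin d) (Fin d) ℂ)
    (σ : Matrix (Fin d × Fin d) (Fin d × Fin d) ℂ) :
    Matrix (Fin d × Fin d) (Fin d × Fin d) ℂ :=
  Matrix.of fun p q => Φ (Matrix.of fun i j => σ (p.1, i) (q.1, j)) p.2 q.2

/-- The seed state after both parties' systems went through the depolarizing channel. -/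
def noisyState (lam : ℝ) {d : ℕ} (σ : Matrix (Fin d × Fin d) (Fin d × Fin d) ℂ) :
    Matrix (Fin d × Fin d) (Fin d × Fin d) ℂ :=
  onFirst (depolarize lam) (onSecond (depolarize lam) σ)

/-- The seed state `σ` generates `P` under depolarizing noise of strength `lam` on each side, by
local measurements without communication. -/
def QuantumGenerates (lam : ℝ) {d n : ℕ} (σ : Matrix (Fin d × Fin d) (Fin d × Fin d) ℂ)
    (P : Matrix (Fin n) (Fin n) ℝ) : Prop :=
  ∃ E F : Fin n → Matrix (Fin d) (Fin d) ℂ, IsPOVM E ∧ IsPOVM F ∧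
    ∀ x y, (P x y : ℂ) = ((E x ⊗ₖ F y) * noisyState lam σ).trace

/-- `P` can be generated from some seed state under noise of strength `lam`. -/
def Reachable (lam : ℝ) {n : ℕ} (P : Matrix (Fin n) (Fin n) ℝ) : Prop :=
  ∃ (d : ℕ) (σ : Matrix (Fin d × Fin d) (Fin d × Fin d) ℂ),
    IsBipartiteState σ ∧ QuantumGenerates lam σ P

/-- The least size of a seed state that generates `P` under noise of strength `lam`
(`∞` if there is none). -/
def quantumCost (lam : ℝ) {n : ℕ} (P : Matrix (Fin n) (Fin n) ℝ) : ℝ≥0∞ :=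
  ⨅ (d : ℕ) (σ : Matrix (Fin d × Fin d) (Fin d × Fin d) ℂ) (_ : IsBipartiteState σ)
    (_ : QuantumGenerates lam σ P), seedSize d

/-- The quantum advantage `S_lam(P)`; in `ℝ≥0∞` a finite number divided by `∞` is `0`. -/
def quantumAdvantage (lam : ℝ) {n : ℕ} (P : Matrix (Fin n) (Fin n) ℝ) : ℝ≥0∞ :=
  classicalComplexity P / quantumCost lam P

/-- `C`, `D` is an `r × r` PSD factorization of `P` adapted to depolarizing noise of strength
`lam`. -/
structure IsNoisyPSDFactorization (lam : ℝ) {n r : ℕ} (P : Matrix (Fin n) (Fin n) ℝ)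
    (C D : Fin n → Matrix (Fin r) (Fin r) ℂ) : Prop where
  left_psd : ∀ x, (C x).PosSemidef
  right_psd : ∀ y, (D y).PosSemidef
  factorization : ∀ x y, (P x y : ℂ) = (C x * D y).trace
  left_isUnit : IsUnit (∑ a, C a)
  right_isUnit : IsUnit (∑ b, D b)
  left_noise : ∀ x,
    (C x - ((lam : ℂ) / (r : ℂ) * (C x * (∑ a, C a)⁻¹).trace) • ∑ a, C a).PosSemidef
  right_noise : ∀ y,
    (D y - ((lam : ℂ) / (r : ℂ) * (D y * (∑ b, D b)⁻¹).trace) • ∑ b, D b).PosSemidef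

/-- The scaled slack matrix `B_m` of two concentric regular `m`-gons, the outer one with inscribed
circle of radius `1` and the inner one with circumscribed circle of radius `k`. Indices start
at `0`. -/
def polygonCorrelation (k : ℝ) (m : ℕ) : Matrix (Fin m) (Fin m) ℝ :=
  Matrix.of fun x y =>
    1 / (m : ℝ) ^ 2 * (1 - k * Real.cos (2 * Real.pi * (((x : ℕ) : ℝ) + ((y : ℕ) : ℝ)) / (m : ℝ)))

end CorrelationGeneration

end

open CorrelationGeneration

namespace CorrelationGeneration

section Trigonometry

theorem sum_exp_two_pi_div {m : ℕ} (hm : 2 ≤ m) :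
    ∑ y : Fin m, Complex.exp (((2 * Real.pi * ((y : ℕ) : ℝ) / m : ℝ) : ℂ) * Complex.I) = 0 := by
  have h := (Complex.isPrimitiveRoot_exp m (by omega)).geom_sum_eq_zero (by omega)
  rw [← Fin.sum_univ_eq_sum_range (fun i => Complex.exp (2 * Real.pi * Complex.I / m) ^ i)] at h
  rw [← h]
  refine Finset.sum_congr rfl fun y _ => ?_
  rw [← Complex.exp_nat_mul]
  congr 1
  push_cast
  ring

theorem sum_cos_two_pi_div {m : ℕ} (hm : 2 ≤ m) :
    ∑ y : Fin m, Real.cos (2 * Real.pi * ((y : ℕ) : ℝ) / m) = 0 := by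
  have h := congrArg Complex.re (sum_exp_two_pi_div hm)
  simpa only [Complex.re_sum, Complex.exp_ofReal_mul_I_re, Complex.zero_re] using h

theorem sum_sin_two_pi_div {m : ℕ} (hm : 2 ≤ m) :
    ∑ y : Fin m, Real.sin (2 * Real.pi * ((y : ℕ) : ℝ) / m) = 0 := by
  have h := congrArg Complex.im (sum_exp_two_pi_div hm)
  simpa only [Complex.im_sum, Complex.exp_ofReal_mul_I_im, Complex.zero_im] using h

theorem sum_linear_cos_sin {m : ℕ} (hm : 2 ≤ m) (a b : ℝ) :
    ∑ y : Fin m, (a * Real.cos (2 * Real.pi * ((y : ℕ) : ℝ) / m)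
      - b * Real.sin (2 * Real.pi * ((y : ℕ) : ℝ) / m)) = 0 := by
  rw [Finset.sum_sub_distrib, ← Finset.mul_sum, ← Finset.mul_sum, sum_cos_two_pi_div hm,
    sum_sin_two_pi_div hm]
  ring

theorem sum_cos_shift {m : ℕ} (hm : 2 ≤ m) (x : ℝ) :
    ∑ y : Fin m, Real.cos (2 * Real.pi * (x + ((y : ℕ) : ℝ)) / m) = 0 := by
  rw [← sum_linear_cos_sin hm (Real.cos (2 * Real.pi * x / m)) (Real.sin (2 * Real.pi * x / m))]
  refine Finset.sum_congr rfl fun y _ => ?_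
  rw [← Real.cos_add]
  congr 1
  ring

end Trigonometry

section Marginals

theorem polygonCorrelation_row_sum {m : ℕ} (hm : 2 ≤ m) (k : ℝ) (x : Fin m) :
    ∑ y, polygonCorrelation k m x y = 1 / m := by
  have hm0 : (m : ℝ) ≠ 0 := by positivity
  simp only [polygonCorrelation, Matrix.of_apply]
  rw [← Finset.mul_sum, Finset.sum_sub_distrib, ← Finset.mul_sum, sum_cos_shift hm]
  simp
  field_simp

theorem polygonCorrelation_comm (k : ℝ) (m : ℕ) (x y : Fin m) :
    polygonCorrelation k m x y = polygonCorrelation k m y x := by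
  simp only [polygonCorrelation, Matrix.of_apply]
  rw [add_comm]

theorem polygonCorrelation_col_sum {m : ℕ} (hm : 2 ≤ m) (k : ℝ) (y : Fin m) :
    ∑ x, polygonCorrelation k m x y = 1 / m := by
  simp_rw [polygonCorrelation_comm k m _ y]
  exact polygonCorrelation_row_sum hm k y

theorem polygonCorrelation_isCorrelation {k : ℝ} (hk0 : 0 < k) (hk1 : k < 1) {m : ℕ}
    (hm : 2 ≤ m) : IsCorrelation (polygonCorrelation k m) where
  nonneg x y := by
    simp only [polygonCorrelation, Matrix.of_apply]
    have h1 := Real.cos_le_one (2 * Real.pi * (((x : ℕ) : ℝ) + ((y : ℕ) : ℝ)) / (m : ℝ))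
    have : 0 ≤ 1 - k * Real.cos (2 * Real.pi * (((x : ℕ) : ℝ) + ((y : ℕ) : ℝ)) / (m : ℝ)) := by
      nlinarith
    positivity
  sum_eq_one := by
    have hm0 : (m : ℝ) ≠ 0 := by positivity
    simp [polygonCorrelation_row_sum hm, hm0]

/-- The polygon correlation is not a product distribution. -/
theorem polygonCorrelation_ne_product {k : ℝ} (hk0 : 0 < k) {m : ℕ} (hm : 2 ≤ m)
    (f g : Fin m → ℂ) (h : ∀ x y, (polygonCorrelation k m x y : ℂ) = f x * g y) : False := by
  have hm0 : (m : ℂ) ≠ 0 := by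
    have : m ≠ 0 := by omega
    exact_mod_cast this
  let z : Fin m := ⟨0, by omega⟩
  have hrow : ∀ x, f x * ∑ y, g y = 1 / m := fun x => by
    rw [Finset.mul_sum, ← Finset.sum_congr rfl fun y _ => h x y, ← Complex.ofReal_sum,
      polygonCorrelation_row_sum hm]
    push_cast
    rfl
  have hcol : ∀ y, (∑ x, f x) * g y = 1 / m := fun y => by
    rw [Finset.sum_mul, ← Finset.sum_congr rfl fun x _ => h x y, ← Complex.ofReal_sum,
      polygonCorrelation_col_sum hm]
    push_cast
    rfl
  have htot : (∑ x, f x) * ∑ y, g y = 1 := by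
    rw [Finset.sum_mul, Finset.sum_congr rfl fun x _ => hrow x]
    simp [hm0]
  have hz : (polygonCorrelation k m z z : ℂ) = 1 / m * (1 / m) := by
    rw [h]
    linear_combination (-(f z * g z)) * htot + (∑ x, f x) * g z * hrow z + (1 / m : ℂ) * hcol z
  have hz' : polygonCorrelation k m z z = 1 / m * (1 / m) := by
    apply Complex.ofReal_injective
    rw [hz]
    push_cast
    rfl
  have hmR : (m : ℝ) ≠ 0 := by positivity
  simp only [polygonCorrelation, Matrix.of_apply, z] at hz'
  simp at hz'
  field_simp at hz'
  linarith

end Marginals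

section Duality

variable {d : ℕ}

theorem trace_mul_depolarize (lam : ℝ) (A ρ : Matrix (Fin d) (Fin d) ℂ) :
    (A * depolarize lam ρ).trace = (depolarize lam A * ρ).trace := by
  simp only [depolarize, Matrix.mul_add, Matrix.add_mul, Matrix.mul_smul, Matrix.smul_mul,
    Matrix.trace_add, Matrix.trace_smul, Matrix.mul_one, Matrix.one_mul, smul_eq_mul]
  ring

theorem trace_kronecker_mul (A B : Matrix (Fin d) (Fin d) ℂ)
    (σ : Matrix (Fin d × Fin d) (Fin d × Fin d) ℂ) :
    ((A ⊗ₖ B) * σ).trace = ∑ i, ∑ j, B i j *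
      (A * Matrix.of fun a b => σ (a, j) (b, i)).trace := by
  simp only [Matrix.trace, Matrix.diag, Matrix.mul_apply, Matrix.kroneckerMap_apply,
    Fintype.sum_prod_type, Matrix.of_apply, Finset.mul_sum]
  rw [Finset.sum_comm]
  refine Finset.sum_congr rfl fun i _ => ?_
  conv_rhs => rw [Finset.sum_comm]
  refine Finset.sum_congr rfl fun a _ => ?_
  rw [Finset.sum_comm]
  refine Finset.sum_congr rfl fun j _ => Finset.sum_congr rfl fun b _ => ?_
  ring

theorem trace_kronecker_mul' (A B : Matrix (Fin d) (Fin d) ℂ)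
    (σ : Matrix (Fin d × Fin d) (Fin d × Fin d) ℂ) :
    ((A ⊗ₖ B) * σ).trace = ∑ i, ∑ j, A i j *
      (B * Matrix.of fun a b => σ (j, a) (i, b)).trace := by
  simp only [Matrix.trace, Matrix.diag, Matrix.mul_apply, Matrix.kroneckerMap_apply,
    Fintype.sum_prod_type, Matrix.of_apply, Finset.mul_sum]
  refine Finset.sum_congr rfl fun i _ => ?_
  rw [Finset.sum_comm]
  refine Finset.sum_congr rfl fun j _ => Finset.sum_congr rfl fun a _ =>
    Finset.sum_congr rfl fun b _ => ?_
  ring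

theorem trace_kronecker_mul_onFirst (lam : ℝ) (A B : Matrix (Fin d) (Fin d) ℂ)
    (σ : Matrix (Fin d × Fin d) (Fin d × Fin d) ℂ) :
    ((A ⊗ₖ B) * onFirst (depolarize lam) σ).trace = ((depolarize lam A ⊗ₖ B) * σ).trace := by
  rw [trace_kronecker_mul, trace_kronecker_mul]
  refine Finset.sum_congr rfl fun i _ => Finset.sum_congr rfl fun j _ => ?_
  rw [← trace_mul_depolarize]
  rfl

theorem trace_kronecker_mul_onSecond (lam : ℝ) (A B : Matrix (Fin d) (Fin d) ℂ)
    (σ : Matrix (Fin d × Fin d) (Fin d × Fin d) ℂ) :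
    ((A ⊗ₖ B) * onSecond (depolarize lam) σ).trace = ((A ⊗ₖ depolarize lam B) * σ).trace := by
  rw [trace_kronecker_mul', trace_kronecker_mul']
  refine Finset.sum_congr rfl fun i _ => Finset.sum_congr rfl fun j _ => ?_
  rw [← trace_mul_depolarize]
  rfl

/-- The depolarizing noise can be moved from the state to the measurement operators. -/
theorem trace_kronecker_mul_noisyState (lam : ℝ) (A B : Matrix (Fin d) (Fin d) ℂ)
    (σ : Matrix (Fin d × Fin d) (Fin d × Fin d) ℂ) :
    ((A ⊗ₖ B) * noisyState lam σ).trace =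
      ((depolarize lam A ⊗ₖ depolarize lam B) * σ).trace := by
  rw [noisyState, trace_kronecker_mul_onFirst, trace_kronecker_mul_onSecond]

theorem trace_kronecker_mul_noisyState_expand (lam : ℝ) (A B : Matrix (Fin d) (Fin d) ℂ)
    (σ : Matrix (Fin d × Fin d) (Fin d × Fin d) ℂ) :
    ((A ⊗ₖ B) * noisyState lam σ).trace =
      (1 - lam) ^ 2 * ((A ⊗ₖ B) * σ).trace
      + lam * (1 - lam) * (((A ⊗ₖ (1 : Matrix (Fin d) (Fin d) ℂ)) * σ).trace * (B.trace / d)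
        + A.trace / d * (((1 : Matrix (Fin d) (Fin d) ℂ) ⊗ₖ B) * σ).trace)
      + lam ^ 2 * (A.trace / d * (B.trace / d)) * σ.trace := by
  rw [trace_kronecker_mul_noisyState]
  simp only [depolarize, Matrix.add_kronecker, Matrix.kronecker_add, Matrix.smul_kronecker,
    Matrix.kronecker_smul, Matrix.add_mul, Matrix.smul_mul, Matrix.trace_add, Matrix.trace_smul,
    smul_eq_mul, Matrix.one_kronecker_one, Matrix.one_mul]
  ring

open scoped MatrixOrder Matrix.Norms.L2Operator in
theorem trace_mul_nonneg_of_posSemidef {n : Type*} [Fintype n] [DecidableEq n]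
    {A B : Matrix n n ℂ} (hA : A.PosSemidef) (hB : B.PosSemidef) : 0 ≤ (A * B).trace := by
  obtain ⟨S, rfl⟩ := CStarAlgebra.nonneg_iff_eq_star_mul_self.mp hB.nonneg
  rw [← Matrix.mul_assoc, Matrix.trace_mul_comm, ← Matrix.mul_assoc]
  exact (hA.mul_mul_conjTranspose_same S).trace_nonneg

theorem sum_trace_kronecker_left {n : ℕ} (E : Fin n → Matrix (Fin d) (Fin d) ℂ)
    (B : Matrix (Fin d) (Fin d) ℂ) (σ : Matrix (Fin d × Fin d) (Fin d × Fin d) ℂ) :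
    ∑ x, ((E x ⊗ₖ B) * σ).trace = (((∑ x, E x) ⊗ₖ B) * σ).trace := by
  simp only [trace_kronecker_mul', Matrix.sum_apply, Finset.sum_mul]
  rw [Finset.sum_comm]
  refine Finset.sum_congr rfl fun i _ => ?_
  rw [Finset.sum_comm]

theorem sum_trace_kronecker_right {n : ℕ} (F : Fin n → Matrix (Fin d) (Fin d) ℂ)
    (A : Matrix (Fin d) (Fin d) ℂ) (σ : Matrix (Fin d × Fin d) (Fin d × Fin d) ℂ) :
    ∑ y, ((A ⊗ₖ F y) * σ).trace = ((A ⊗ₖ (∑ y, F y)) * σ).trace := by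
  simp only [trace_kronecker_mul, Matrix.sum_apply, Finset.sum_mul]
  rw [Finset.sum_comm]
  refine Finset.sum_congr rfl fun i _ => ?_
  rw [Finset.sum_comm]

end Duality

section Unreachable

theorem IsBipartiteState.dim_ne_zero {d : ℕ}
    {σ : Matrix (Fin d × Fin d) (Fin d × Fin d) ℂ} (hσ : IsBipartiteState σ) : d ≠ 0 := by
  rintro rfl
  simpa [Matrix.trace] using hσ.trace_eq_one

/-- If `P` is generated under noise from `σ`, its covariance is `(1 - lam) ^ 2` times the
covariance of the distribution `Q` that the same measurements yield on `σ` itself. -/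
theorem QuantumGenerates.exists_noiseless {lam : ℝ} {d n : ℕ}
    {σ : Matrix (Fin d × Fin d) (Fin d × Fin d) ℂ} (hσ : IsBipartiteState σ)
    {P : Matrix (Fin n) (Fin n) ℝ} (h : QuantumGenerates lam σ P) :
    ∃ Q : Matrix (Fin n) (Fin n) ℝ, IsCorrelation Q ∧ ∀ x y,
      P x y - (∑ b, P x b) * (∑ a, P a y) =
        (1 - lam) ^ 2 * (Q x y - (∑ b, Q x b) * (∑ a, Q a y)) := by
  obtain ⟨E, F, hE, hF, hP⟩ := h
  have hd : (d : ℂ) ≠ 0 := by exact_mod_cast hσ.dim_ne_zero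
  have hQ : ∀ x y, 0 ≤ ((E x ⊗ₖ F y) * σ).trace := fun x y =>
    trace_mul_nonneg_of_posSemidef ((hE.posSemidef x).kronecker (hF.posSemidef y)) hσ.posSemidef
  have hre : ∀ x y, ((((E x ⊗ₖ F y) * σ).trace.re : ℝ) : ℂ) = ((E x ⊗ₖ F y) * σ).trace :=
    fun x y => Complex.ext rfl (by simpa using (Complex.nonneg_iff.mp (hQ x y)).2)
  have hA : ∀ x, ∑ y, ((E x ⊗ₖ F y) * σ).trace =
      ((E x ⊗ₖ (1 : Matrix (Fin d) (Fin d) ℂ)) * σ).trace := fun x => by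
    rw [sum_trace_kronecker_right, hF.sum_eq_one]
  have hB : ∀ y, ∑ x, ((E x ⊗ₖ F y) * σ).trace =
      (((1 : Matrix (Fin d) (Fin d) ℂ) ⊗ₖ F y) * σ).trace := fun y => by
    rw [sum_trace_kronecker_left, hE.sum_eq_one]
  have hone : (((1 : Matrix (Fin d) (Fin d) ℂ) ⊗ₖ (1 : Matrix (Fin d) (Fin d) ℂ)) * σ).trace = 1 := by
    rw [Matrix.one_kronecker_one, Matrix.one_mul, hσ.trace_eq_one]
  have hPA : ∀ x, ∑ y, (P x y : ℂ) =
      (1 - lam) * ((E x ⊗ₖ (1 : Matrix (Fin d) (Fin d) ℂ)) * σ).trace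
        + lam * ((E x).trace / d) := fun x => by
    rw [Finset.sum_congr rfl fun y _ => hP x y, sum_trace_kronecker_right, hF.sum_eq_one,
      trace_kronecker_mul_noisyState_expand, hone, hσ.trace_eq_one, Matrix.trace_one,
      Fintype.card_fin, div_self hd]
    ring
  have hPB : ∀ y, ∑ x, (P x y : ℂ) =
      (1 - lam) * (((1 : Matrix (Fin d) (Fin d) ℂ) ⊗ₖ F y) * σ).trace
        + lam * ((F y).trace / d) := fun y => by
    rw [Finset.sum_congr rfl fun x _ => hP x y, sum_trace_kronecker_left, hE.sum_eq_one,
      trace_kronecker_mul_noisyState_expand, hone, hσ.trace_eq_one, Matrix.trace_one,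
      Fintype.card_fin, div_self hd]
    ring
  refine ⟨Matrix.of fun x y => ((E x ⊗ₖ F y) * σ).trace.re, ⟨?_, ?_⟩, ?_⟩
  · exact fun x y => (Complex.nonneg_iff.mp (hQ x y)).1
  · apply Complex.ofReal_injective
    push_cast
    simp only [Matrix.of_apply, hre, hA]
    rw [sum_trace_kronecker_left, hE.sum_eq_one, hone]
  · intro x y
    apply Complex.ofReal_injective
    push_cast
    simp only [Matrix.of_apply, hre, hA, hB, hPA, hPB]
    rw [hP, trace_kronecker_mul_noisyState_expand, hσ.trace_eq_one]
    ring

theorem cos_two_pi_int (n : ℕ) {m : ℕ} (hm : m ≠ 0) :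
    Real.cos (2 * Real.pi * ((n * m : ℕ) : ℝ) / m) = 1 := by
  have hm0 : (m : ℝ) ≠ 0 := by exact_mod_cast hm
  have : 2 * Real.pi * ((n * m : ℕ) : ℝ) / m = n * (2 * Real.pi) := by
    push_cast
    field_simp
  rw [this, Real.cos_nat_mul_two_pi]

theorem dvd_val_add_val_neg {m : ℕ} [NeZero m] (x : Fin m) :
    m ∣ (x : ℕ) + ((-x : Fin m) : ℕ) := by
  have := congrArg Fin.val (add_neg_cancel x)
  rw [Fin.val_add] at this
  exact Nat.dvd_of_mod_eq_zero (by simpa using this)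

theorem polygonCorrelation_neg {m : ℕ} [NeZero m] (k : ℝ) (x : Fin m) :
    polygonCorrelation k m x (-x) = 1 / (m : ℝ) ^ 2 * (1 - k) := by
  obtain ⟨n, hn⟩ := dvd_val_add_val_neg x
  simp only [polygonCorrelation, Matrix.of_apply]
  rw [← Nat.cast_add, hn, mul_comm m n, cos_two_pi_int n (NeZero.ne m), mul_one]

theorem sqrt_le_of_reachable {k : ℝ} (hk0 : 0 < k) {m : ℕ} (hm : 2 ≤ m) {lam : ℝ}
    (hlam : lam ≤ 1) (h : Reachable lam (polygonCorrelation k m)) : Real.sqrt k ≤ 1 - lam := by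
  obtain ⟨d, σ, hσ, hgen⟩ := h
  obtain ⟨Q, hQ, hcov⟩ := hgen.exists_noiseless hσ
  have : NeZero m := ⟨by omega⟩
  have hm0 : (0 : ℝ) < m := by positivity
  set α : Fin m → ℝ := fun x => ∑ b, Q x b with hα
  set β : Fin m → ℝ := fun y => ∑ a, Q a y with hβ
  have hα0 : ∀ x, 0 ≤ α x := fun x => Finset.sum_nonneg fun b _ => hQ.nonneg x b
  have hβ0 : ∀ y, 0 ≤ β y := fun y => Finset.sum_nonneg fun a _ => hQ.nonneg a y
  have hαs : ∑ x, α x = 1 := hQ.sum_eq_one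
  have hβs : ∑ x, β (-x) = 1 := by
    rw [show ∑ x, β (-x) = ∑ x, β x from Equiv.sum_comp (Equiv.neg (Fin m)) β, hβ,
      Finset.sum_comm]
    exact hQ.sum_eq_one
  have key : ∀ x, Real.sqrt k / m ≤ (1 - lam) * ((α x + β (-x)) / 2) := fun x => by
    have h1 := hcov x (-x)
    rw [polygonCorrelation_neg, polygonCorrelation_row_sum hm, polygonCorrelation_col_sum hm] at h1
    change _ = (1 - lam) ^ 2 * (Q x (-x) - α x * β (-x)) at h1
    have h2 : k / m ^ 2 ≤ (1 - lam) ^ 2 * (α x * β (-x)) := by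
      have h3 := mul_nonneg (sq_nonneg (1 - lam)) (hQ.nonneg x (-x))
      have h4 : k / (m : ℝ) ^ 2 = -(1 / (m : ℝ) ^ 2 * (1 - k) - 1 / m * (1 / m)) := by
        field_simp
        ring
      rw [h4, h1]
      linarith
    have h5 : 0 ≤ (1 - lam) * ((α x + β (-x)) / 2) :=
      mul_nonneg (by linarith) (by linarith [hα0 x, hβ0 (-x)])
    refine le_of_sq_le_sq ?_ h5
    rw [div_pow, Real.sq_sqrt hk0.le]
    refine h2.trans ?_
    rw [mul_pow]
    refine mul_le_mul_of_nonneg_left ?_ (sq_nonneg _)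
    nlinarith [sq_nonneg (α x - β (-x))]
  have hsum := Finset.sum_le_sum fun x (_ : x ∈ Finset.univ) => key x
  rw [← Finset.mul_sum, ← Finset.sum_div Finset.univ (fun x => α x + β (-x)),
    Finset.sum_add_distrib, hαs, hβs] at hsum
  simp only [Finset.sum_const, Finset.card_univ, Fintype.card_fin, nsmul_eq_mul] at hsum
  rw [mul_div_cancel₀ _ hm0.ne'] at hsum
  linarith

theorem quantumCost_eq_top_of_not_reachable {lam : ℝ} {n : ℕ} {P : Matrix (Fin n) (Fin n) ℝ}
    (h : ¬ Reachable lam P) : quantumCost lam P = ⊤ := by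
  simp only [quantumCost, iInf_eq_top]
  exact fun d σ hσ hgen => absurd ⟨d, σ, hσ, hgen⟩ h

end Unreachable

section Polygon

/-- `t` is a nonnegative lift of the point `(a, b)` of the plane: its products with the columns of
`v` are the slacks of `(a, b)` with respect to the regular `m`-gon circumscribed about the unit
circle. -/
def LiesOver {d m : ℕ} (v : Matrix (Fin d) (Fin m) ℝ) (a b : ℝ) (t : Fin d → ℝ) : Prop :=
  (∀ i, 0 ≤ t i) ∧ ∀ y : Fin m,
    1 - (a * Real.cos (2 * Real.pi * ((y : ℕ) : ℝ) / m)
      - b * Real.sin (2 * Real.pi * ((y : ℕ) : ℝ) / m)) = ∑ i, t i * v i y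

theorem LiesOver.sum_eq {d m : ℕ} (hm : 2 ≤ m) {v : Matrix (Fin d) (Fin m) ℝ}
    (hv : IsStochastic v) {a b : ℝ} {t : Fin d → ℝ} (h : LiesOver v a b t) :
    ∑ i, t i = m := by
  have h1 : ∑ y : Fin m, ∑ i, t i * v i y = ∑ i, t i := by
    rw [Finset.sum_comm]
    simp only [← Finset.mul_sum, hv.sum_eq_one, mul_one]
  rw [← h1, ← Finset.sum_congr rfl fun y _ => h.2 y, Finset.sum_sub_distrib,
    sum_linear_cos_sin hm]
  simp

theorem cos_add_neg_fin {m : ℕ} [NeZero m] (x : Fin m) :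
    Real.cos (2 * Real.pi * ((x : ℕ) : ℝ) / m + 2 * Real.pi * (((-x : Fin m) : ℕ) : ℝ) / m) = 1 := by
  obtain ⟨n, hn⟩ := dvd_val_add_val_neg x
  rw [← cos_two_pi_int n (NeZero.ne m), mul_comm n m, ← hn]
  congr 1
  push_cast
  ring

theorem LiesOver.radius_le_one {d m : ℕ} [NeZero m] {v : Matrix (Fin d) (Fin m) ℝ}
    (hv : IsStochastic v) (n : Fin m) {ρ : ℝ} {t : Fin d → ℝ}
    (h : LiesOver v (ρ * Real.cos (2 * Real.pi * ((n : ℕ) : ℝ) / m))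
      (ρ * Real.sin (2 * Real.pi * ((n : ℕ) : ℝ) / m)) t) : ρ ≤ 1 := by
  have h1 := h.2 (-n)
  have h2 : 0 ≤ ∑ i, t i * v i (-n) :=
    Finset.sum_nonneg fun i _ => mul_nonneg (h.1 i) (hv.nonneg i _)
  have h3 := cos_add_neg_fin n
  rw [Real.cos_add] at h3
  rw [← h1] at h2
  nlinarith

/-- On the ray through a vertex of the regular `m`-gon, the points that have a lift include one
that is farthest from the origin. -/
theorem exists_farthest {d m : ℕ} (hm : 2 ≤ m) {v : Matrix (Fin d) (Fin m) ℝ}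
    (hv : IsStochastic v) (n : Fin m) {k : ℝ} (hk : 0 ≤ k) {t₀ : Fin d → ℝ}
    (h₀ : LiesOver v (k * Real.cos (2 * Real.pi * ((n : ℕ) : ℝ) / m))
      (k * Real.sin (2 * Real.pi * ((n : ℕ) : ℝ) / m)) t₀) :
    ∃ (ρ : ℝ) (t : Fin d → ℝ), k ≤ ρ ∧ ρ ≤ 1 ∧
      LiesOver v (ρ * Real.cos (2 * Real.pi * ((n : ℕ) : ℝ) / m))
        (ρ * Real.sin (2 * Real.pi * ((n : ℕ) : ℝ) / m)) t ∧
      ∀ (ρ' : ℝ) (t' : Fin d → ℝ),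
        LiesOver v (ρ' * Real.cos (2 * Real.pi * ((n : ℕ) : ℝ) / m))
          (ρ' * Real.sin (2 * Real.pi * ((n : ℕ) : ℝ) / m)) t' → ρ' ≤ ρ := by
  have : NeZero m := ⟨by omega⟩
  set θ := 2 * Real.pi * ((n : ℕ) : ℝ) / m with hθ
  set S : Set (ℝ × (Fin d → ℝ)) :=
    {q | 0 ≤ q.1 ∧ LiesOver v (q.1 * Real.cos θ) (q.1 * Real.sin θ) q.2} with hS
  have hclosed : IsClosed S := by
    simp only [hS, LiesOver, Set.ofPred_and, Set.ofPred_forall]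
    refine (isClosed_le (by fun_prop) (by fun_prop)).inter (IsClosed.inter ?_ ?_)
    · exact isClosed_iInter fun i => isClosed_le (by fun_prop) (by fun_prop)
    · exact isClosed_iInter fun i => isClosed_eq (by fun_prop) (by fun_prop)
  have hsub : S ⊆ Set.Icc (0, fun _ => 0) (1, fun _ => (m : ℝ)) := by
    rintro ⟨ρ, t⟩ ⟨hρ, ht⟩
    refine ⟨⟨hρ, ht.1⟩, ⟨ht.radius_le_one hv n, fun i => ?_⟩⟩
    change t i ≤ (m : ℝ)
    rw [← ht.sum_eq hm hv]
    exact Finset.single_le_sum (fun i _ => ht.1 i) (Finset.mem_univ i)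
  have hcomp : IsCompact S := isCompact_Icc.of_isClosed_subset hclosed hsub
  obtain ⟨⟨ρ, t⟩, ⟨hρ, ht⟩, hmax⟩ :=
    hcomp.exists_isMaxOn ⟨(k, t₀), hk, h₀⟩ continuous_fst.continuousOn
  have hkρ : k ≤ ρ := hmax (show (k, t₀) ∈ S from ⟨hk, h₀⟩)
  refine ⟨ρ, t, hkρ, ht.radius_le_one hv n, ht, fun ρ' t' h' => ?_⟩
  rcases le_total 0 ρ' with h0 | h0
  · exact hmax (show (ρ', t') ∈ S from ⟨h0, h'⟩)
  · exact h0.trans hρ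

/-- Two lifts with the same support can be moved along the line through them; a lift of a point
strictly beyond that line then shows that neither is farthest on its ray. -/
theorem exists_lift_beyond {d m : ℕ} {v : Matrix (Fin d) (Fin m) ℝ} {p₁ p₂ q₁ q₂ a b : ℝ}
    {t t' s : Fin d → ℝ} (ht : LiesOver v p₁ p₂ t) (ht' : LiesOver v q₁ q₂ t')
    (hs : LiesOver v (a * p₁ + b * q₁) (a * p₂ + b * q₂) s)
    (hsupp : ∀ i, t i = 0 → t' i = 0) :
    ∃ ε : ℝ, 0 < ε ∧ ∃ r, LiesOver v ((1 + ε * (a + b - 1)) * p₁)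
      ((1 + ε * (a + b - 1)) * p₂) r := by
  have hev : ∀ᶠ ε in nhdsWithin (0 : ℝ) (Set.Ioi 0), ∀ i,
      0 ≤ t i + ε * (s i - (1 - b) * t i - b * t' i) := by
    rw [Filter.eventually_all]
    intro i
    rcases (ht.1 i).eq_or_lt with h0 | h0
    · filter_upwards [self_mem_nhdsWithin] with ε hε
      rw [← h0, hsupp i h0.symm]
      simpa using mul_nonneg (le_of_lt hε) (hs.1 i)
    · refine Filter.Eventually.filter_mono nhdsWithin_le_nhds ?_
      have hc : ContinuousAt (fun ε : ℝ => t i + ε * (s i - (1 - b) * t i - b * t' i)) 0 := by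
        fun_prop
      have := hc.eventually (lt_mem_nhds (show (0 : ℝ) < t i + 0 * _ by simpa using h0))
      exact this.mono fun ε hε => hε.le
  obtain ⟨ε, hpos, hε⟩ := (hev.and self_mem_nhdsWithin).exists
  refine ⟨ε, hε, _, hpos, fun y => ?_⟩
  have e : ∑ i, (t i + ε * (s i - (1 - b) * t i - b * t' i)) * v i y =
      (1 - ε * (1 - b)) * ∑ i, t i * v i y + ε * ∑ i, s i * v i y
        - ε * b * ∑ i, t' i * v i y := by
    simp only [Finset.mul_sum, ← Finset.sum_add_distrib, ← Finset.sum_sub_distrib]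
    exact Finset.sum_congr rfl fun i _ => by ring
  rw [e, ← ht.2 y, ← ht'.2 y, ← hs.2 y]
  ring

/-- Every direction is within `π / m` of a vertex of the regular `m`-gon. -/
theorem exists_vertex_near {m : ℕ} [NeZero m] (φ : ℝ) :
    ∃ x : Fin m, Real.cos (Real.pi / m) ≤ Real.cos (φ - 2 * Real.pi * ((x : ℕ) : ℝ) / m) := by
  have hm0 : (0 : ℝ) < m := by exact_mod_cast NeZero.pos m
  set N : ℤ := round (φ * m / (2 * Real.pi)) with hN
  have hround := abs_sub_round (φ * m / (2 * Real.pi))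
  rw [← hN] at hround
  have hmZ : (0 : ℤ) < m := by exact_mod_cast NeZero.pos m
  have hnn := Int.emod_nonneg N hmZ.ne'
  have hlt := Int.emod_lt_of_pos N hmZ
  refine ⟨⟨(N % m).toNat, by omega⟩, ?_⟩
  have hx : (((N % m).toNat : ℕ) : ℝ) = (N : ℝ) - m * ((N / m : ℤ) : ℝ) := by
    have h1 : (((N % m).toNat : ℕ) : ℤ) = N - m * (N / m) := by
      rw [Int.toNat_of_nonneg hnn, Int.emod_def]
    exact_mod_cast congrArg (Int.cast (R := ℝ)) h1
  have hang : φ - 2 * Real.pi * (((N % m).toNat : ℕ) : ℝ) / m =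
      2 * Real.pi / m * (φ * m / (2 * Real.pi) - N) + ((N / m : ℤ) : ℝ) * (2 * Real.pi) := by
    rw [hx]
    field_simp
    ring
  rw [hang, Real.cos_add_int_mul_two_pi, ← Real.cos_abs (2 * Real.pi / m * _)]
  have hb : |2 * Real.pi / m * (φ * m / (2 * Real.pi) - N)| ≤ Real.pi / m := by
    rw [abs_mul, abs_of_pos (by positivity)]
    calc 2 * Real.pi / m * |φ * m / (2 * Real.pi) - N| ≤ 2 * Real.pi / m * (1 / 2) := by gcongr
      _ = Real.pi / m := by ring
  refine Real.cos_le_cos_of_nonneg_of_le_pi (abs_nonneg _) ?_ hb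
  exact div_le_self Real.pi_pos.le (by exact_mod_cast NeZero.one_le)

theorem two_mul_sq_sub_one_lt_cos_sub {c A B : ℝ} (hc : 0 ≤ c) (hA : c < Real.cos A)
    (hB : c < Real.cos B) : 2 * c ^ 2 - 1 < Real.cos (A - B) := by
  rw [Real.cos_sub]
  have h1 : c ^ 2 < Real.cos A * Real.cos B := by nlinarith
  have h2 : Real.sin A ^ 2 ≤ 1 - c ^ 2 := by nlinarith [Real.sin_sq_add_cos_sq A]
  have h3 : Real.sin B ^ 2 ≤ 1 - c ^ 2 := by nlinarith [Real.sin_sq_add_cos_sq B]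
  nlinarith [sq_nonneg (Real.sin A + Real.sin B)]

/-- Two points of the unit disc whose directions are far apart span a line that leaves a vertex of
the inner polygon strictly beyond it. -/
theorem exists_vertex_beyond {m : ℕ} (hm : 4 ≤ m) {k : ℝ} (hk0 : 0 < k)
    (hk : Real.cos (2 * Real.pi / m) / Real.cos (Real.pi / m) ^ 2 < k)
    {θ θ' ρ ρ' : ℝ} (hρ : 0 < ρ) (hρ1 : ρ ≤ 1) (hρ' : 0 < ρ') (hρ1' : ρ' ≤ 1)
    (hsep : 4 * Real.pi / m ≤ θ' - θ) (hlt : θ' - θ < Real.pi) :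
    ∃ (x : Fin m) (a b : ℝ), 1 < a + b ∧
      k * Real.cos (2 * Real.pi * ((x : ℕ) : ℝ) / m) =
        a * (ρ * Real.cos θ) + b * (ρ' * Real.cos θ') ∧
      k * Real.sin (2 * Real.pi * ((x : ℕ) : ℝ) / m) =
        a * (ρ * Real.sin θ) + b * (ρ' * Real.sin θ') := by
  have : NeZero m := ⟨by omega⟩
  have hm0 : (0 : ℝ) < m := by exact_mod_cast NeZero.pos m
  have hm4 : (4 : ℝ) ≤ m := by exact_mod_cast hm
  have hpi := Real.pi_pos
  have hΔ : 0 < Real.sin (θ' - θ) :=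
    Real.sin_pos_of_pos_of_lt_pi (lt_of_lt_of_le (by positivity) hsep) hlt
  have hpm : Real.pi / m ≤ Real.pi / 4 := by gcongr
  have hcm : 0 < Real.cos (Real.pi / m) :=
    Real.cos_pos_of_mem_Ioo ⟨by linarith [div_pos hpi hm0], by linarith⟩
  have hcm1 := Real.cos_le_one (Real.pi / m)
  have hc0 : 0 ≤ Real.cos (2 * Real.pi / m) := by
    refine Real.cos_nonneg_of_mem_Icc ⟨by linarith [show (0:ℝ) < 2 * Real.pi / m by positivity], ?_⟩
    rw [mul_div_assoc]
    linarith
  have hkc : Real.cos (2 * Real.pi / m) < k * Real.cos (Real.pi / m) := by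
    rw [div_lt_iff₀ (by positivity)] at hk
    nlinarith [mul_pos hk0 hcm]
  -- the functional with value `1` at both points
  set n₁ : ℝ := (Real.sin θ' / ρ - Real.sin θ / ρ') / Real.sin (θ' - θ) with hn₁
  set n₂ : ℝ := (Real.cos θ / ρ' - Real.cos θ' / ρ) / Real.sin (θ' - θ) with hn₂
  have hsin : Real.sin (θ' - θ) = Real.sin θ' * Real.cos θ - Real.cos θ' * Real.sin θ :=
    Real.sin_sub _ _
  have hp : n₁ * Real.cos θ + n₂ * Real.sin θ = 1 / ρ := by
    rw [hn₁, hn₂, div_mul_eq_mul_div, div_mul_eq_mul_div, ← add_div, div_eq_iff hΔ.ne', hsin]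
    ring
  have hp' : n₁ * Real.cos θ' + n₂ * Real.sin θ' = 1 / ρ' := by
    rw [hn₁, hn₂, div_mul_eq_mul_div, div_mul_eq_mul_div, ← add_div, div_eq_iff hΔ.ne', hsin]
    ring
  set z : ℂ := ⟨n₁, n₂⟩ with hz
  set N := ‖z‖ with hN
  set φ := z.arg with hφ
  have hz1 : n₁ = N * Real.cos φ := (Complex.norm_mul_cos_arg z).symm
  have hz2 : n₂ = N * Real.sin φ := (Complex.norm_mul_sin_arg z).symm
  have hq : N * Real.cos (φ - θ) = 1 / ρ := by
    rw [← hp, hz1, hz2, Real.cos_sub]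
    ring
  have hq' : N * Real.cos (φ - θ') = 1 / ρ' := by
    rw [← hp', hz1, hz2, Real.cos_sub]
    ring
  have hN0 : 0 ≤ N := norm_nonneg z
  have hbig : 1 < k * N * Real.cos (Real.pi / m) := by
    by_contra hcon
    push Not at hcon
    have hle : ∀ {ψ r : ℝ}, 0 < r → r ≤ 1 → N * Real.cos ψ = 1 / r →
        Real.cos (2 * Real.pi / m) < Real.cos ψ := fun {ψ r} hr hr1 h => by
      have h1 : 1 ≤ N * Real.cos ψ := by rw [h]; exact (one_le_div hr).mpr hr1
      have hNpos : 0 < N := hN0.lt_of_ne (by rintro h0; rw [← h0] at h1; linarith)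
      refine hkc.trans_le (le_of_mul_le_mul_left ?_ hNpos)
      linarith
    have h1 := two_mul_sq_sub_one_lt_cos_sub hc0 (hle hρ hρ1 hq) (hle hρ' hρ1' hq')
    rw [← Real.cos_two_mul, show φ - θ - (φ - θ') = θ' - θ by ring] at h1
    refine absurd h1 (not_lt.mpr ?_)
    refine Real.cos_le_cos_of_nonneg_of_le_pi (by positivity) hlt.le ?_
    refine le_trans (le_of_eq ?_) hsep
    ring
  obtain ⟨x, hx⟩ := exists_vertex_near (m := m) φ
  set ξ := 2 * Real.pi * ((x : ℕ) : ℝ) / m with hξ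
  refine ⟨x, k * Real.sin (θ' - ξ) / (ρ * Real.sin (θ' - θ)),
    k * Real.sin (ξ - θ) / (ρ' * Real.sin (θ' - θ)), ?_, ?_, ?_⟩
  · have hval : k * Real.sin (θ' - ξ) / (ρ * Real.sin (θ' - θ)) +
        k * Real.sin (ξ - θ) / (ρ' * Real.sin (θ' - θ)) = k * (N * Real.cos (φ - ξ)) := by
      have : N * Real.cos (φ - ξ) = n₁ * Real.cos ξ + n₂ * Real.sin ξ := by
        rw [hz1, hz2, Real.cos_sub]
        ring
      rw [this, hn₁, hn₂, Real.sin_sub θ' ξ, Real.sin_sub ξ θ]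
      field_simp
      ring
    rw [hval]
    calc 1 < k * N * Real.cos (Real.pi / m) := hbig
      _ ≤ k * N * Real.cos (φ - ξ) := by gcongr
      _ = k * (N * Real.cos (φ - ξ)) := by ring
  · have e : k * Real.sin (θ' - ξ) / (ρ * Real.sin (θ' - θ)) * (ρ * Real.cos θ) +
        k * Real.sin (ξ - θ) / (ρ' * Real.sin (θ' - θ)) * (ρ' * Real.cos θ') =
        k * (Real.sin (θ' - ξ) * Real.cos θ + Real.sin (ξ - θ) * Real.cos θ')
          / Real.sin (θ' - θ) := by
      field_simp
    rw [e, eq_div_iff hΔ.ne', hsin, Real.sin_sub, Real.sin_sub]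
    ring
  · have e : k * Real.sin (θ' - ξ) / (ρ * Real.sin (θ' - θ)) * (ρ * Real.sin θ) +
        k * Real.sin (ξ - θ) / (ρ' * Real.sin (θ' - θ)) * (ρ' * Real.sin θ') =
        k * (Real.sin (θ' - ξ) * Real.sin θ + Real.sin (ξ - θ) * Real.sin θ')
          / Real.sin (θ' - θ) := by
      field_simp
    rw [e, eq_div_iff hΔ.ne', hsin, Real.sin_sub, Real.sin_sub]
    ring

/-- A nonnegative factorization of the polygon correlation has inner dimension at least
`log₂ (m / 4)`. -/
theorem div_four_le_two_pow {d m : ℕ} (hm : 4 ≤ m) {k : ℝ} (hk0 : 0 < k)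
    (hk : Real.cos (2 * Real.pi / m) / Real.cos (Real.pi / m) ^ 2 < k)
    {u : Fin m → Fin d → ℝ} (hu : ∀ x i, 0 ≤ u x i) {v : Matrix (Fin d) (Fin m) ℝ}
    (hv : IsStochastic v) (h : ∀ x y, polygonCorrelation k m x y = ∑ i, u x i * v i y) :
    m / 4 ≤ 2 ^ d := by
  have hm0 : (0 : ℝ) < m := by positivity
  have hvert : ∀ x : Fin m, LiesOver v (k * Real.cos (2 * Real.pi * ((x : ℕ) : ℝ) / m))
      (k * Real.sin (2 * Real.pi * ((x : ℕ) : ℝ) / m)) (fun i => (m : ℝ) ^ 2 * u x i) := fun x => by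
    refine ⟨fun i => mul_nonneg (by positivity) (hu x i), fun y => ?_⟩
    simp only [mul_assoc, ← Finset.mul_sum]
    rw [← h x y, polygonCorrelation, Matrix.of_apply, mul_add, add_div, Real.cos_add]
    field_simp
  let dir : Fin (m / 4) → Fin m := fun j => ⟨2 * j, by omega⟩
  choose ρ t hkρ hρ1 ht hmax using fun j : Fin (m / 4) =>
    exists_farthest (by omega) hv (dir j) hk0.le (hvert (dir j))
  have hne : ∀ j j' : Fin (m / 4), j < j' → {i | t j i = 0} ≠ {i | t j' i = 0} := by
    intro j j' hjj' hset
    have hjR : ((j : ℕ) : ℝ) + 1 ≤ ((j' : ℕ) : ℝ) := by exact_mod_cast hjj'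
    have hj'R : 4 * ((j' : ℕ) : ℝ) < m := by
      have : 4 * (j' : ℕ) < m := by omega
      exact_mod_cast this
    have hj0 : (0 : ℝ) ≤ ((j : ℕ) : ℝ) := by positivity
    have hang : 2 * Real.pi * ((dir j' : ℕ) : ℝ) / m - 2 * Real.pi * ((dir j : ℕ) : ℝ) / m =
        4 * Real.pi * (((j' : ℕ) : ℝ) - ((j : ℕ) : ℝ)) / m := by
      simp only [dir]
      push_cast
      ring
    obtain ⟨x, a, b, hab, h1, h2⟩ := exists_vertex_beyond hm hk0 hk
      (hk0.trans_le (hkρ j)) (hρ1 j) (hk0.trans_le (hkρ j')) (hρ1 j')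
      (θ := 2 * Real.pi * ((dir j : ℕ) : ℝ) / m) (θ' := 2 * Real.pi * ((dir j' : ℕ) : ℝ) / m)
      (by
        rw [hang]
        refine div_le_div_of_nonneg_right ?_ hm0.le
        nlinarith [Real.pi_pos])
      (by
        rw [hang, div_lt_iff₀ hm0]
        nlinarith [Real.pi_pos])
    have hx := hvert x
    rw [h1, h2] at hx
    obtain ⟨ε, hε, r, hr⟩ := exists_lift_beyond (ht j) (ht j') hx
      (fun i hi => (Set.ext_iff.mp hset i).mp hi)
    rw [← mul_assoc, ← mul_assoc] at hr
    have h3 := hmax j _ r hr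
    have h4 : 0 < ε * (a + b - 1) * ρ j :=
      mul_pos (mul_pos hε (by linarith)) (hk0.trans_le (hkρ j))
    linarith
  have hinj : Function.Injective fun j : Fin (m / 4) => {i | t j i = 0} := by
    intro j j' hjj'
    rcases lt_trichotomy j j' with hlt | heq | hlt
    · exact absurd hjj' (hne j j' hlt)
    · exact heq
    · exact absurd hjj'.symm (hne j' j hlt)
  simpa [Fintype.card_set] using Fintype.card_le_of_injective _ hinj

end Polygon

section ClassicalComplexity

theorem ClassicallyGenerates.div_four_le_two_pow {d m : ℕ} (hm : 4 ≤ m) {k : ℝ} (hk0 : 0 < k)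
    (hk : Real.cos (2 * Real.pi / m) / Real.cos (Real.pi / m) ^ 2 < k)
    {P' : Matrix (Fin d) (Fin d) ℝ} (hP' : IsCorrelation P')
    (h : ClassicallyGenerates P' (polygonCorrelation k m)) : m / 4 ≤ 2 ^ d := by
  obtain ⟨K, L, hK, hL, hP⟩ := h
  refine CorrelationGeneration.div_four_le_two_pow hm hk0 hk (d := d)
    (u := fun x j => ∑ i, P' i j * K i x)
    (fun x j => Finset.sum_nonneg fun i _ => mul_nonneg (hP'.nonneg i j) (hK.nonneg i x)) hL
    fun x y => ?_
  rw [hP, Finset.sum_comm]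
  simp only [Finset.sum_mul]

theorem ClassicallyGenerates.two_le {d m : ℕ} (hm : 2 ≤ m) {k : ℝ} (hk0 : 0 < k)
    {P' : Matrix (Fin d) (Fin d) ℝ} (hP' : IsCorrelation P')
    (h : ClassicallyGenerates P' (polygonCorrelation k m)) : 2 ≤ d := by
  obtain ⟨K, L, hK, hL, hP⟩ := h
  by_contra hd
  obtain rfl | rfl : d = 0 ∨ d = 1 := by omega
  · simpa using hP'.sum_eq_one
  · refine polygonCorrelation_ne_product hk0 hm (fun x => (P' 0 0 * K 0 x : ℝ))
      (fun y => (L 0 y : ℝ)) fun x y => ?_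
    rw [hP]
    simp

theorem log_log_le_clog {d m : ℕ} (hd : 2 ≤ d) (hm : 3 ≤ m) (h : m / 4 ≤ 2 ^ d) :
    1 / 3 * Real.log (Real.log m) ≤ (Nat.clog 2 d : ℝ) := by
  set L := Nat.clog 2 d with hL
  have hL1 : 1 ≤ L := Nat.clog_pos one_lt_two hd
  have hdL : d ≤ 2 ^ L := Nat.le_pow_clog one_lt_two d
  have hmd : m ≤ 2 ^ (d + 3) := by
    have : 1 ≤ 2 ^ d := Nat.one_le_two_pow
    rw [pow_add]
    omega
  have hlog2 : Real.log 2 ≤ 1 := by linarith [Real.log_two_lt_d9]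
  have hm0 : (0 : ℝ) < m := by positivity
  have hm3 : (3 : ℝ) ≤ m := by exact_mod_cast hm
  have h1 : Real.log m ≤ (2 : ℝ) ^ (L + 2) := by
    calc Real.log m ≤ Real.log ((2 : ℝ) ^ (d + 3)) := by
          apply Real.log_le_log hm0
          exact_mod_cast hmd
      _ = ((d + 3 : ℕ) : ℝ) * Real.log 2 := Real.log_pow _ _
      _ ≤ ((d + 3 : ℕ) : ℝ) * 1 := by gcongr
      _ ≤ (2 : ℝ) ^ (L + 2) := by
          rw [mul_one]
          have : d + 3 ≤ 2 ^ (L + 2) := by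
            rw [pow_add]
            omega
          exact_mod_cast this
  have h2 : Real.log (Real.log m) ≤ L + 2 := by
    calc Real.log (Real.log m) ≤ Real.log ((2 : ℝ) ^ (L + 2)) :=
          Real.log_le_log (Real.log_pos (by linarith)) h1
      _ = ((L + 2 : ℕ) : ℝ) * Real.log 2 := Real.log_pow _ _
      _ ≤ ((L + 2 : ℕ) : ℝ) * 1 := by gcongr
      _ = L + 2 := by push_cast; ring
  have hL1' : (1 : ℝ) ≤ L := by exact_mod_cast hL1
  linarith

theorem log_log_le_classicalComplexity {m : ℕ} (hm : 3 ≤ m) {k : ℝ} (hk0 : 0 < k)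
    (hk : Real.cos (2 * Real.pi / m) / Real.cos (Real.pi / m) ^ 2 < k) :
    ENNReal.ofReal (1 / 3 * Real.log (Real.log m)) ≤
      classicalComplexity (polygonCorrelation k m) := by
  refine le_iInf fun d => le_iInf fun P' => le_iInf fun hP' => le_iInf fun hgen => ?_
  have h4 : m / 4 ≤ 2 ^ d := by
    rcases hm.eq_or_lt with rfl | hm4
    · simp
    · exact hgen.div_four_le_two_pow hm4 hk0 hk hP'
  rw [seedSize, ← ENNReal.ofReal_natCast]
  exact ENNReal.ofReal_le_ofReal (log_log_le_clog (hgen.two_le (by omega) hk0 hP') hm h4)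

end ClassicalComplexity

section Qubit

/-- The qubit operator `p I + r (cos θ Z + sin θ X)`. -/
noncomputable def qubitEffect (p r θ : ℝ) : Matrix (Fin 2) (Fin 2) ℂ :=
  !![((p + r * Real.cos θ : ℝ) : ℂ), ((r * Real.sin θ : ℝ) : ℂ);
     ((r * Real.sin θ : ℝ) : ℂ), ((p - r * Real.cos θ : ℝ) : ℂ)]

theorem qubitEffect_posSemidef {p r : ℝ} (θ : ℝ) (hr : 0 ≤ r) (hrp : r ≤ p) :
    (qubitEffect p r θ).PosSemidef := by
  obtain ⟨w, hw0, hw1⟩ : ∃ w : Fin 2 → ℂ, w 0 = (Real.cos (θ / 2) : ℂ) ∧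
      w 1 = (Real.sin (θ / 2) : ℂ) := ⟨![_, _], rfl, rfl⟩
  have hdec : qubitEffect p r θ = ((p - r : ℝ) : ℂ) • (1 : Matrix (Fin 2) (Fin 2) ℂ)
      + ((2 * r : ℝ) : ℂ) • Matrix.vecMulVec w (star w) := by
    have hc : Real.cos θ = 2 * Real.cos (θ / 2) ^ 2 - 1 := by
      rw [← Real.cos_two_mul]
      congr 1
      ring
    have hs : Real.sin θ = 2 * Real.sin (θ / 2) * Real.cos (θ / 2) := by
      rw [← Real.sin_two_mul]
      congr 1
      ring
    have h1 : Real.sin (θ / 2) ^ 2 = 1 - Real.cos (θ / 2) ^ 2 := Real.sin_sq _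
    have hsC : ((Real.sin (θ / 2) : ℝ) : ℂ) * ((Real.sin (θ / 2) : ℝ) : ℂ)
        = 1 - ((Real.cos (θ / 2) : ℝ) : ℂ) ^ 2 := by
      rw [← sq]
      exact_mod_cast h1
    rw [qubitEffect, hc, hs]
    ext i j
    fin_cases i <;> fin_cases j <;>
      simp [hw0, hw1, Matrix.vecMulVec_apply, -Complex.ofReal_cos, -Complex.ofReal_sin]
    · ring
    · ring
    · ring
    · rw [hsC]
      ring
  rw [hdec]
  refine Matrix.PosSemidef.add (Matrix.PosSemidef.one.smul ?_)
    ((Matrix.posSemidef_vecMulVec_self_star w).smul ?_)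
  · exact_mod_cast sub_nonneg.mpr hrp
  · exact_mod_cast mul_nonneg zero_le_two hr

theorem qubitEffect_trace (p r θ : ℝ) : (qubitEffect p r θ).trace = 2 * p := by
  simp [qubitEffect, Matrix.trace_fin_two]
  ring

theorem qubitEffect_sub_smul_one (p q r θ : ℝ) :
    qubitEffect p r θ - (q : ℂ) • (1 : Matrix (Fin 2) (Fin 2) ℂ) = qubitEffect (p - q) r θ := by
  ext i j
  fin_cases i <;> fin_cases j <;> simp [qubitEffect]
  · ring
  · ring

theorem depolarize_qubitEffect (lam p r θ : ℝ) :
    depolarize lam (qubitEffect p r θ) = qubitEffect p ((1 - lam) * r) θ := by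
  rw [depolarize, qubitEffect_trace]
  ext i j
  fin_cases i <;> fin_cases j <;> simp [qubitEffect] <;> ring

theorem sum_mul_qubitEffect (p r θ q s η : ℝ) :
    ∑ i, ∑ j, qubitEffect p r θ i j * qubitEffect q s η i j =
      ((2 * (p * q + r * s * Real.cos (θ - η)) : ℝ) : ℂ) := by
  rw [Real.cos_sub]
  simp [Fin.sum_univ_two, qubitEffect]
  ring

theorem trace_qubitEffect_mul (p r θ q s η : ℝ) :
    (qubitEffect p r θ * qubitEffect q s η).trace =
      ((2 * (p * q + r * s * Real.cos (θ - η)) : ℝ) : ℂ) := by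
  rw [Real.cos_sub]
  simp [Matrix.trace_fin_two, qubitEffect]
  ring

theorem sum_qubitEffect_left {m : ℕ} (hm : 2 ≤ m) (p r : ℝ) :
    ∑ x : Fin m, qubitEffect p r (2 * Real.pi * ((x : ℕ) : ℝ) / m) =
      ((m * p : ℝ) : ℂ) • (1 : Matrix (Fin 2) (Fin 2) ℂ) := by
  have hc := sum_cos_two_pi_div hm
  have hs := sum_sin_two_pi_div hm
  ext i j
  rw [Matrix.sum_apply]
  fin_cases i <;> fin_cases j <;>
    simp only [qubitEffect, Matrix.of_apply, Matrix.cons_val', Matrix.cons_val_zero,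
      Matrix.cons_val_one, Fin.zero_eta, Fin.mk_one, Matrix.cons_val_fin_one,
      ← Complex.ofReal_sum, Finset.sum_add_distrib, Finset.sum_sub_distrib, ← Finset.mul_sum,
      hc, hs] <;> simp

theorem sum_qubitEffect_right {m : ℕ} (hm : 2 ≤ m) (p r : ℝ) :
    ∑ y : Fin m, qubitEffect p r (Real.pi - 2 * Real.pi * ((y : ℕ) : ℝ) / m) =
      ((m * p : ℝ) : ℂ) • (1 : Matrix (Fin 2) (Fin 2) ℂ) := by
  have hc := sum_cos_two_pi_div hm
  have hs := sum_sin_two_pi_div hm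
  ext i j
  rw [Matrix.sum_apply]
  fin_cases i <;> fin_cases j <;>
    simp only [qubitEffect, Matrix.of_apply, Matrix.cons_val', Matrix.cons_val_zero,
      Matrix.cons_val_one, Fin.zero_eta, Fin.mk_one, Matrix.cons_val_fin_one,
      Real.cos_pi_sub, Real.sin_pi_sub, Finset.sum_neg_distrib,
      ← Complex.ofReal_sum, Finset.sum_add_distrib, Finset.sum_sub_distrib, ← Finset.mul_sum,
      hc, hs] <;> simp

theorem cos_vertex_angles (m : ℕ) (x y : ℝ) :
    Real.cos (2 * Real.pi * x / m - (Real.pi - 2 * Real.pi * y / m)) =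
      -Real.cos (2 * Real.pi * (x + y) / m) := by
  rw [← Real.cos_sub_pi]
  congr 1
  ring

end Qubit

section Factorization

theorem qubitEffect_noise_posSemidef {lam p r θ : ℝ} {m : ℕ} (hm : m ≠ 0) (hp : 0 < p)
    (hr : 0 ≤ r) (hrp : r ≤ (1 - lam) * p) {S : Matrix (Fin 2) (Fin 2) ℂ}
    (hS : S = ((m * p : ℝ) : ℂ) • (1 : Matrix (Fin 2) (Fin 2) ℂ)) :
    (qubitEffect p r θ - ((lam : ℂ) / ((2 : ℕ) : ℂ) * (qubitEffect p r θ * S⁻¹).trace) • S).PosSemidef := by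
  have hmp : ((m * p : ℝ) : ℂ) ≠ 0 := by
    have : (m : ℝ) ≠ 0 := by exact_mod_cast hm
    exact_mod_cast mul_ne_zero this hp.ne'
  have hinv : S⁻¹ = ((m * p : ℝ) : ℂ)⁻¹ • (1 : Matrix (Fin 2) (Fin 2) ℂ) := by
    apply Matrix.inv_eq_right_inv
    rw [hS, Matrix.smul_mul, Matrix.one_mul, smul_smul, mul_inv_cancel₀ hmp, one_smul]
  have hcoef : ((lam : ℂ) / ((2 : ℕ) : ℂ) * (qubitEffect p r θ * S⁻¹).trace) • S =
      ((lam * p : ℝ) : ℂ) • (1 : Matrix (Fin 2) (Fin 2) ℂ) := by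
    rw [hinv, hS, Matrix.mul_smul, Matrix.mul_one, Matrix.trace_smul, qubitEffect_trace, smul_smul]
    congr 1
    rw [smul_eq_mul]
    field_simp
    push_cast
    ring
  rw [hcoef, qubitEffect_sub_smul_one]
  exact qubitEffect_posSemidef θ hr (by linarith)

theorem exists_isNoisyPSDFactorization {k : ℝ} (hk0 : 0 < k) {m : ℕ} (hm : 2 ≤ m) {lam : ℝ}
    (hlam0 : 0 ≤ lam) (hlam : lam ≤ 1 - Real.sqrt k) :
    ∃ C D : Fin m → Matrix (Fin 2) (Fin 2) ℂ,
      IsNoisyPSDFactorization lam (polygonCorrelation k m) C D := by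
  have hm0 : m ≠ 0 := by omega
  have hmR : (0 : ℝ) < m := by positivity
  have h2 : (0 : ℝ) < Real.sqrt 2 := by positivity
  obtain ⟨p, hp⟩ : ∃ p : ℝ, p = 1 / (m * Real.sqrt 2) := ⟨_, rfl⟩
  have hp0 : 0 < p := by rw [hp]; positivity
  have hpp : 2 * (p * p) = 1 / (m : ℝ) ^ 2 := by
    rw [hp]
    field_simp
    rw [Real.sq_sqrt zero_le_two]
  have hsk := Real.sqrt_nonneg k
  have hr0 : 0 ≤ Real.sqrt k * p := by positivity
  have hrp : Real.sqrt k * p ≤ (1 - lam) * p := by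
    have : Real.sqrt k ≤ 1 - lam := by linarith
    gcongr
  have hrp' : Real.sqrt k * p ≤ p := by nlinarith
  have hunit : IsUnit (((m * p : ℝ) : ℂ) • (1 : Matrix (Fin 2) (Fin 2) ℂ)) := by
    have hne : ((m * p : ℝ) : ℂ) ≠ 0 := by exact_mod_cast (mul_pos hmR hp0).ne'
    rw [Matrix.isUnit_iff_isUnit_det, Matrix.det_smul, Matrix.det_one, mul_one]
    exact (hne.isUnit).pow _
  refine ⟨fun x => qubitEffect p (Real.sqrt k * p) (2 * Real.pi * ((x : ℕ) : ℝ) / m),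
    fun y => qubitEffect p (Real.sqrt k * p) (Real.pi - 2 * Real.pi * ((y : ℕ) : ℝ) / m),
    fun x => qubitEffect_posSemidef _ hr0 hrp', fun y => qubitEffect_posSemidef _ hr0 hrp',
    fun x y => ?_, ?_, ?_, fun x => ?_, fun y => ?_⟩
  · rw [trace_qubitEffect_mul, cos_vertex_angles, polygonCorrelation, Matrix.of_apply, ← hpp]
    congr 1
    linear_combination 2 * p ^ 2 * Real.cos (2 * Real.pi * (((x : ℕ) : ℝ) + ((y : ℕ) : ℝ)) / m) *
      Real.mul_self_sqrt hk0.le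
  · rw [sum_qubitEffect_left hm]
    exact hunit
  · rw [sum_qubitEffect_right hm]
    exact hunit
  · exact qubitEffect_noise_posSemidef hm0 hp0 hr0 hrp (sum_qubitEffect_left hm _ _)
  · exact qubitEffect_noise_posSemidef hm0 hp0 hr0 hrp (sum_qubitEffect_right hm _ _)

end Factorization

section Reachable

/-- The maximally entangled state of two qubits. -/
noncomputable def bellState : Matrix (Fin 2 × Fin 2) (Fin 2 × Fin 2) ℂ :=
  (1 / 2 : ℂ) • Matrix.vecMulVec (fun p => if p.1 = p.2 then 1 else 0)
    (star fun p => if p.1 = p.2 then 1 else 0)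

theorem bellState_isBipartiteState : IsBipartiteState bellState where
  posSemidef := (Matrix.posSemidef_vecMulVec_self_star _).smul (by
    rw [Complex.nonneg_iff]
    norm_num)
  trace_eq_one := by
    simp [bellState, Matrix.trace, Fintype.sum_prod_type, Matrix.vecMulVec_apply]

theorem trace_kronecker_mul_bellState (A B : Matrix (Fin 2) (Fin 2) ℂ) :
    ((A ⊗ₖ B) * bellState).trace = 1 / 2 * ∑ i, ∑ j, A i j * B i j := by
  simp [bellState, Matrix.trace, Matrix.mul_apply, Fintype.sum_prod_type, Fin.sum_univ_two,
    Matrix.vecMulVec_apply]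
  ring

theorem bellState_generates {k : ℝ} (hk0 : 0 < k) {m : ℕ} (hm : 2 ≤ m) {lam : ℝ}
    (hlam : lam ≤ 1 - Real.sqrt k) :
    QuantumGenerates lam bellState (polygonCorrelation k m) := by
  have hmR : (0 : ℝ) < m := by positivity
  have hsk : 0 < Real.sqrt k := Real.sqrt_pos.mpr hk0
  have hl : 0 < 1 - lam := by linarith
  obtain ⟨r, hr⟩ : ∃ r : ℝ, r = Real.sqrt k / (1 - lam) * (1 / m) := ⟨_, rfl⟩
  have hr0 : 0 ≤ r := by rw [hr]; positivity
  have hr1 : r ≤ 1 / m := by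
    rw [hr]
    refine mul_le_of_le_one_left (by positivity) ?_
    rw [div_le_one hl]
    linarith
  have hrl : (1 - lam) * r = Real.sqrt k * (1 / m) := by
    rw [hr]
    field_simp
  have hone : ((m * (1 / m) : ℝ) : ℂ) = 1 := by
    rw [mul_one_div_cancel hmR.ne']
    simp
  refine ⟨fun x => qubitEffect (1 / m) r (2 * Real.pi * ((x : ℕ) : ℝ) / m),
    fun y => qubitEffect (1 / m) r (Real.pi - 2 * Real.pi * ((y : ℕ) : ℝ) / m),
    ⟨fun x => qubitEffect_posSemidef _ hr0 hr1, ?_⟩,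
    ⟨fun y => qubitEffect_posSemidef _ hr0 hr1, ?_⟩, fun x y => ?_⟩
  · rw [sum_qubitEffect_left hm, hone, one_smul]
  · rw [sum_qubitEffect_right hm, hone, one_smul]
  · rw [trace_kronecker_mul_noisyState, depolarize_qubitEffect, depolarize_qubitEffect, hrl,
      trace_kronecker_mul_bellState, sum_mul_qubitEffect, cos_vertex_angles, polygonCorrelation,
      Matrix.of_apply]
    have e : Real.sqrt k * (1 / m) * (Real.sqrt k * (1 / m)) = k * (1 / (m : ℝ) ^ 2) := by
      rw [mul_mul_mul_comm, Real.mul_self_sqrt hk0.le]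
      ring
    rw [e]
    push_cast
    ring

theorem QuantumGenerates.two_le {lam : ℝ} {d m : ℕ} (hm : 2 ≤ m) {k : ℝ} (hk0 : 0 < k)
    {σ : Matrix (Fin d × Fin d) (Fin d × Fin d) ℂ} (hσ : IsBipartiteState σ)
    (h : QuantumGenerates lam σ (polygonCorrelation k m)) : 2 ≤ d := by
  obtain ⟨E, F, hE, hF, hP⟩ := h
  by_contra hd
  obtain rfl | rfl : d = 0 ∨ d = 1 := by omega
  · exact hσ.dim_ne_zero rfl
  · refine polygonCorrelation_ne_product hk0 hm
      (fun x => E x 0 0) (fun y => F y 0 0 * noisyState lam σ (0, 0) (0, 0)) fun x y => ?_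
    rw [hP]
    simp [Matrix.trace, Matrix.mul_apply, Fintype.sum_prod_type, mul_assoc]

theorem quantumCost_polygonCorrelation {k : ℝ} (hk0 : 0 < k) {m : ℕ} (hm : 2 ≤ m) {lam : ℝ}
    (hlam : lam ≤ 1 - Real.sqrt k) : quantumCost lam (polygonCorrelation k m) = 1 := by
  apply le_antisymm
  · refine iInf_le_of_le 2 <| iInf_le_of_le bellState <|
      iInf_le_of_le bellState_isBipartiteState <|
      iInf_le_of_le (bellState_generates hk0 hm hlam) ?_
    simp [seedSize, Nat.clog_of_two_le]
  · refine le_iInf fun d => le_iInf fun σ => le_iInf fun hσ => le_iInf fun hgen => ?_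
    rw [seedSize]
    exact_mod_cast Nat.clog_pos one_lt_two (hgen.two_le hm hk0 hσ)

theorem quantumAdvantage_polygonCorrelation {k : ℝ} (hk0 : 0 < k) {m : ℕ} (hm : 2 ≤ m) {lam : ℝ}
    (hlam : lam ≤ 1 - Real.sqrt k) :
    quantumAdvantage lam (polygonCorrelation k m) =
      classicalComplexity (polygonCorrelation k m) := by
  rw [quantumAdvantage, quantumCost_polygonCorrelation hk0 hm hlam, div_one]

end Reachable

end CorrelationGeneration

theorem theorem3 :
    (∀ (k : ℝ), 0 < k → k < 1 → ∀ (m : ℕ), 2 ≤ m →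
      IsCorrelation (polygonCorrelation k m) ∧
      ∀ (lam : ℝ), 0 ≤ lam → lam ≤ 1 - Real.sqrt k →
        (∃ C D : Fin m → Matrix (Fin 2) (Fin 2) ℂ,
          IsNoisyPSDFactorization lam (polygonCorrelation k m) C D) ∧
        Reachable lam (polygonCorrelation k m) ∧
        quantumAdvantage lam (polygonCorrelation k m) =
          classicalComplexity (polygonCorrelation k m)) ∧
    (∃ c : ℝ, 0 < c ∧ ∀ (m : ℕ), 3 ≤ m → ∀ (k : ℝ), 0 < k → k < 1 →
      Real.cos (2 * Real.pi / m) / Real.cos (Real.pi / m) ^ 2 < k →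
      ∀ (lam : ℝ), 0 ≤ lam → lam ≤ 1 - Real.sqrt k →
        ENNReal.ofReal (c * Real.log (Real.log m)) ≤
          quantumAdvantage lam (polygonCorrelation k m)) ∧
    (∀ (k : ℝ), 0 < k → k < 1 → ∀ (m : ℕ), 2 ≤ m →
      ∀ (lam : ℝ), 1 - Real.sqrt k < lam → lam ≤ 1 →
        ¬ Reachable lam (polygonCorrelation k m) ∧
        quantumAdvantage lam (polygonCorrelation k m) = 0) := by
  refine ⟨fun k hk0 hk1 m hm => ⟨polygonCorrelation_isCorrelation hk0 hk1 hm,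
    fun lam hlam0 hlam => ⟨exists_isNoisyPSDFactorization hk0 hm hlam0 hlam,
      ⟨2, bellState, bellState_isBipartiteState, bellState_generates hk0 hm hlam⟩,
      quantumAdvantage_polygonCorrelation hk0 hm hlam⟩⟩,
    ⟨1 / 3, by norm_num, fun m hm k hk0 hk1 hk lam hlam0 hlam => ?_⟩,
    fun k hk0 hk1 m hm lam hlam hlam1 => ?_⟩
  · rw [quantumAdvantage_polygonCorrelation hk0 (by omega) hlam]
    exact log_log_le_classicalComplexity hm hk0 hk
  · have hnot : ¬ Reachable lam (polygonCorrelation k m) := fun h => by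
      linarith [sqrt_le_of_reachable hk0 hm hlam1 h]
    exact ⟨hnot, by rw [quantumAdvantage, quantumCost_eq_top_of_not_reachable hnot,
      ENNReal.div_top]⟩
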